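/- Notation. For $n\ge 0$ let $B^n=\{x\in\mathbb R^n:\|x\|\le 1\}$ be the closed Euclidean unit ball (neighborhoods of points of $B^n$ are taken relative to $B^n$), and $[N]=\{1,\dots,N\}$. For $x\in\mathbb R^T$ let $\mathrm{prog}_\alpha(x)=\max\{i\ge 1: |x[i]|>\alpha\}$ with $\max\emptyset=0$, and let $x[\le p]$ be the vector obtained from $x$ by setting all coordinates after the first $p$ to zero. A sequence $f_1,\dots,f_N:B^T\to\mathbb R$ is an $\alpha$-robust $N$-element zero-chain if every $x\in B^T$ has a neighborhood such that for all $y$ in it, all $i\in[N]$ and all integers $p\ge \mathrm{prog}_\alpha(x)$, $$f_i(y)=\begin{cases} f_i(y[\le p]) & i<p+1,\\ f_i(y[\le p+1]) & i=p+1,\\ f_N(y[\le p]) & i>p+1.\end{cases}$$ A local oracle on $B^d$ is any mapping $(f,x)\mapsto \mathcal O_f(x)$, for $f:B^d\to\mathbb R$ and $x\in B^d$, with values in a measurable space, such that $\mathcal O_f(x)=\mathcal O_{g}(x)$ whenever $f$ and $g$ agree in a neighborhood of $x$. An $N$-element algorithm with randomness $\zeta$ operating on $g_1,\dots,g_N:B^d\to\mathbb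 R$ produces queries $(i_t,x_t)\in[N]\times B^d$, $t\ge 1$, by $$(i_t,x_t)=Q_t\bigl(\zeta,\mathcal O_{g_{i_1}}(x_1),\dots,\mathcal O_{g_{i_{t-1}}}(x_{t-1})\bigr)$$ with measurable functions $Q_t$. Proposition. Let $\delta,\alpha\in(0,1)$ and $N,T\in\mathbb N$ with $T\le N/2$, and let $(f_i)_{i\in[N]}$ be an $\alpha$-robust $N$-element zero-chain on $B^T$. Let $d\in\mathbb N$ satisfy $d\ge T+\frac{2}{\alpha^2}\log\frac{4NT^2}{\delta}$. Draw $U$ uniformly (i.e. from the $O(d)$-invariant probability measure) from the set of real $d\times T$ matrices with orthonormal columns, draw $\Pi$ uniformly from the permutations of $[N]$, and let the algorithm's randomness $\zeta$ have any distribution, with $\zeta,\Pi,U$ independent. Let $\tilde f_i(x)=f_{\Pi^{-1}(i)}(U^\top x)$ for $x\in B^d$, and let $\{(i_t,x_t)\}_{t\ge1}$ be the queries of any $N$-element algorithm operating on $\tilde f_1,\dots,\tilde f_N$ through any local oracle, where the queries are assumed to be random variables, i.e. measurable functions of $(\zeta,\Pi,U)$. Then with probability at least $1-\delta$, $$\mathrm{prog}_\alpha(U^\top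 x_t)<T\quad\text{for all } t\le \tfrac1{16}N\Bigl(T-\log\tfrac2\delta\Bigr).$$ -/

import Mathlib

open MeasureTheory Topology
open scoped Matrix

namespace ProgControl

/-- The closed Euclidean unit ball of `ℝⁿ`, as a (topological and Borel) space of its own. -/
abbrev UnitBall (n : ℕ) : Type := Metric.closedBall (0 : EuclideanSpace ℝ (Fin n)) 1

/-- `prog α x` is the largest `i ∈ {1, …, T}` whose coordinate satisfies `|x[i]| > α`, and `0` if
there is none.  (`Fin T` counts from `0`, so `j : Fin T` stands for the coordinate `j + 1`.) -/
noncomputable def prog {T : ℕ} (α : ℝ) (x : EuclideanSpace ℝ (Fin T)) : ℕ :=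
  (Finset.univ.filter fun j : Fin T => α < |x j|).sup fun j => (j : ℕ) + 1

/-- `trunc p v` keeps the first `p` coordinates of `v` and sets the others to zero. -/
noncomputable def trunc {T : ℕ} (p : ℕ) (v : EuclideanSpace ℝ (Fin T)) :
    EuclideanSpace ℝ (Fin T) :=
  WithLp.toLp 2 fun j => if (j : ℕ) < p then v j else 0

theorem norm_trunc_le {T : ℕ} (p : ℕ) (v : EuclideanSpace ℝ (Fin T)) : ‖trunc p v‖ ≤ ‖v‖ := by
  rw [EuclideanSpace.norm_eq, EuclideanSpace.norm_eq]
  refine Real.sqrt_le_sqrt (Finset.sum_le_sum fun j _ => ?_)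
  by_cases h : (j : ℕ) < p
  · simp [trunc, h]
  · have h0 : trunc p v j = 0 := by simp [trunc, h]
    rw [h0, norm_zero, zero_pow two_ne_zero]
    exact sq_nonneg _

/-- Truncation as a map of the unit ball to itself. -/
noncomputable def truncBall {T : ℕ} (p : ℕ) (y : UnitBall T) : UnitBall T :=
  ⟨trunc p y.1, by
    have h := y.2
    rw [mem_closedBall_zero_iff] at h ⊢
    exact (norm_trunc_le p y.1).trans h⟩

/-- `α`-robust `N`-element zero-chains.  The element `i : Fin N` is the element
number `i + 1 ∈ {1, …, N}`; in particular the last element is `⟨N - 1, _⟩`.  Neighbourhoods are taken in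
the domain, the unit ball. -/
def IsRobustZeroChain {N T : ℕ} (α : ℝ) (f : Fin N → UnitBall T → ℝ) : Prop :=
  ∀ x : UnitBall T, ∀ᶠ y in 𝓝 x, ∀ (i : Fin N) (p : ℕ), prog α x.1 ≤ p →
    ((i : ℕ) + 1 < p + 1 → f i y = f i (truncBall p y)) ∧
    ((i : ℕ) + 1 = p + 1 → f i y = f i (truncBall (p + 1) y)) ∧
    (p + 1 < (i : ℕ) + 1 →
      f i y = f ⟨N - 1, Nat.sub_lt i.pos Nat.one_pos⟩ (truncBall p y))

/-- A local oracle for real functions on the domain `D` with responses in `R`: an arbitrary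
mapping whose response at `x` is the same for two functions that agree near `x`. -/
structure LocalOracle (D : Type*) [TopologicalSpace D] (R : Type*) where
  /-- The response to the query of the function `f` at the point `x`. -/
  response : (D → ℝ) → D → R
  isLocal : ∀ (f g : D → ℝ) (x : D), f =ᶠ[𝓝 x] g → response f x = response g x

/-- An (adaptive, randomized) `N`-element algorithm on the domain `D` with randomness in `Z` and
oracle responses in `R`: after `t` responses it produces its next query, an index in `[N]` and
a point of `D`, as a measurable function of its randomness and of these responses. -/
structure NElementAlgorithm (N : ℕ) (D Z R : Type*)
    [MeasurableSpace D] [MeasurableSpace Z] [MeasurableSpace R] where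
  /-- `next t` is the rule for the query number `t + 1`. -/
  next : (t : ℕ) → Z × (Fin t → R) → Fin N × D
  measurable_next : ∀ t, Measurable (next t)

namespace NElementAlgorithm

variable {N : ℕ} {D Z R : Type*} [TopologicalSpace D]
  [MeasurableSpace D] [MeasurableSpace Z] [MeasurableSpace R]

/-- The first `t` oracle responses when the algorithm `A` with randomness `ζ` operates on the
functions `f`. -/
def history (A : NElementAlgorithm N D Z R) (O : LocalOracle D R) (f : Fin N → D → ℝ) (ζ : Z) :
    (t : ℕ) → Fin t → R
  | 0 => Fin.elim0
  | t + 1 =>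
    let q := A.next t (ζ, A.history O f ζ t)
    Fin.snoc (α := fun _ => R) (A.history O f ζ t) (O.response (f q.1) q.2)

/-- The query number `t + 1` (index and point) when the algorithm `A` with randomness `ζ` operates
on the functions `f`. -/
def query (A : NElementAlgorithm N D Z R) (O : LocalOracle D R) (f : Fin N → D → ℝ) (ζ : Z)
    (t : ℕ) : Fin N × D :=
  A.next t (ζ, A.history O f ζ t)

end NElementAlgorithm

/-- The Borel σ-algebra of a space of real matrices. -/
instance instMeasurableSpaceMatrix (m n : ℕ) : MeasurableSpace (Matrix (Fin m) (Fin n) ℝ) :=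
  inferInstanceAs (MeasurableSpace (Fin m → Fin n → ℝ))

instance instBorelSpaceMatrix (m n : ℕ) : BorelSpace (Matrix (Fin m) (Fin n) ℝ) :=
  inferInstanceAs (BorelSpace (Fin m → Fin n → ℝ))

instance instCompactSpaceOrthogonalGroup (d : ℕ) :
    CompactSpace (Matrix.orthogonalGroup (Fin d) ℝ) := by
  refine isCompact_iff_compactSpace.1 (?_ : IsCompact
    (Matrix.orthogonalGroup (Fin d) ℝ : Set (Matrix (Fin d) (Fin d) ℝ)))
  have hK : IsCompact (Set.univ.pi fun _ : Fin d => Set.univ.pi fun _ : Fin d =>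
      Set.Icc (-1 : ℝ) 1) :=
    isCompact_univ_pi fun _ => isCompact_univ_pi fun _ => isCompact_Icc
  refine IsCompact.of_isClosed_subset hK ?_ ?_
  · have : ((Matrix.orthogonalGroup (Fin d) ℝ : Set (Matrix (Fin d) (Fin d) ℝ))) =
        {Q | Q * star Q = 1} := by
      ext Q
      exact Matrix.mem_orthogonalGroup_iff (Fin d) ℝ
    rw [this]
    exact isClosed_eq (by fun_prop) continuous_const
  · intro Q hQ i _ j _
    have h := congrFun (congrFun ((Matrix.mem_orthogonalGroup_iff (Fin d) ℝ).1 hQ) i) i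
    simp only [Matrix.mul_apply, Matrix.one_apply_eq] at h
    have h2 : Q i j * Q i j ≤ 1 := by
      rw [← h]
      exact Finset.single_le_sum (f := fun k => Q i k * Q i k)
        (fun k _ => mul_self_nonneg _) (Finset.mem_univ j)
    exact abs_le.1 (abs_le_one_iff_mul_self_le_one.2 h2)

/-- The `d × T` orthogonal matrices: real `d × T` matrices with orthonormal columns. -/
abbrev Stiefel (d T : ℕ) : Type := {U : Matrix (Fin d) (Fin T) ℝ // Uᵀ * U = 1}

/-- The first `T` columns of an orthogonal `d × d` matrix. -/
def firstColumns {d T : ℕ} (h : T ≤ d) (Q : Matrix.orthogonalGroup (Fin d) ℝ) : Stiefel d T :=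
  ⟨(Q : Matrix (Fin d) (Fin d) ℝ).submatrix id (Fin.castLE h), by
    have hQ : (Q : Matrix (Fin d) (Fin d) ℝ)ᵀ * (Q : Matrix (Fin d) (Fin d) ℝ) = 1 :=
      (Matrix.mem_orthogonalGroup_iff' (Fin d) ℝ).1 Q.2
    ext i j
    have := congrFun (congrFun hQ (Fin.castLE h i)) (Fin.castLE h j)
    simpa [Matrix.mul_apply, Matrix.one_apply] using this⟩

/-- The Haar probability measure of the orthogonal group `O(d)`. -/
noncomputable def haarOrthogonal (d : ℕ) : Measure (Matrix.orthogonalGroup (Fin d) ℝ) :=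
  Measure.haarMeasure ⊤

/-- The uniform distribution on the `d × T` orthogonal matrices: the law of the first `T` columns
of a Haar distributed orthogonal `d × d` matrix, which is the unique `O(d)`-invariant probability
measure.  (There are no such matrices if `d < T`, and the measure is then `0`.) -/
noncomputable def stiefelUniform (d T : ℕ) : Measure (Stiefel d T) :=
  if h : T ≤ d then (haarOrthogonal d).map (firstColumns h) else 0

/-- Every set of permutations of the finite set `[N]` is measurable. -/
instance instMeasurableSpacePerm (N : ℕ) : MeasurableSpace (Equiv.Perm (Fin N)) := ⊤

/-- The uniform distribution on the permutations of `[N]`. -/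
noncomputable def permUniform (N : ℕ) : Measure (Equiv.Perm (Fin N)) :=
  (PMF.uniformOfFintype (Equiv.Perm (Fin N))).toMeasure

/-- The vector `Uᵀ x`. -/
noncomputable def pullback {d T : ℕ} (U : Stiefel d T) (x : EuclideanSpace ℝ (Fin d)) :
    EuclideanSpace ℝ (Fin T) :=
  WithLp.toLp 2 (Matrix.mulVec U.1ᵀ x.ofLp)

theorem norm_pullback_le {d T : ℕ} (U : Stiefel d T) (x : EuclideanSpace ℝ (Fin d)) :
    ‖pullback U x‖ ≤ ‖x‖ := by
  set u : EuclideanSpace ℝ (Fin T) := pullback U x with hu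
  let w : EuclideanSpace ℝ (Fin d) := WithLp.toLp 2 (Matrix.mulVec U.1 u.ofLp)
  have hdot : ∀ (n : ℕ) (a b : EuclideanSpace ℝ (Fin n)),
      inner ℝ a b = dotProduct a.ofLp b.ofLp := by
    intro n a b
    simp [PiLp.inner_apply, dotProduct, mul_comm]
  have h1 : inner ℝ w w = inner ℝ u u := by
    rw [hdot, hdot]
    change dotProduct (Matrix.mulVec U.1 u.ofLp) (Matrix.mulVec U.1 u.ofLp) = _
    rw [Matrix.dotProduct_mulVec, Matrix.vecMul_mulVec, U.2, Matrix.vecMul_one]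
  have h2 : inner ℝ x w = inner ℝ u u := by
    rw [hdot, hdot]
    change dotProduct x.ofLp (Matrix.mulVec U.1 u.ofLp) = _
    rw [Matrix.dotProduct_mulVec, ← Matrix.mulVec_transpose]
    rfl
  rw [real_inner_self_eq_norm_sq] at h2
  rw [real_inner_self_eq_norm_sq, real_inner_self_eq_norm_sq] at h1
  have h3 : ‖w‖ = ‖u‖ := (sq_eq_sq₀ (norm_nonneg _) (norm_nonneg _)).1 h1
  have h4 := real_inner_le_norm x w
  rw [h2, h3] at h4
  rcases (norm_nonneg u).eq_or_lt with h0 | h0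
  · rw [← h0]; exact norm_nonneg x
  · nlinarith

/-- `x ↦ Uᵀ x` as a map from the unit ball of `ℝᵈ` to the unit ball of `ℝᵀ`. -/
noncomputable def pullbackBall {d T : ℕ} (U : Stiefel d T) (x : UnitBall d) : UnitBall T :=
  ⟨pullback U x.1, by
    have h := x.2
    rw [mem_closedBall_zero_iff] at h ⊢
    exact (norm_pullback_le U x.1).trans h⟩

/-- The randomized instance: `f̃ᵢ(x) = f_{Π⁻¹(i)}(Uᵀ x)` on the unit ball of `ℝᵈ`. -/
noncomputable def randomizedInstance {N d T : ℕ} (f : Fin N → UnitBall T → ℝ)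
    (π : Equiv.Perm (Fin N)) (U : Stiefel d T) : Fin N → UnitBall d → ℝ :=
  fun i x => f (π.symm i) (pullbackBall U x)

end ProgControl

namespace ProgControl

/-! Fix `ζ`. The level of a run counts how many of the values `π 0, π 1, …` have been queried in
order, stopping at `T`; a run is controlled while no query has progress beyond its level. By
robustness and locality, a controlled run at level `k < T` has seen only the first `k` columns of
`U` and, through its hits, the first `k` values of `π` (`response_eq`, `run_agree`). Full progress
within `n` queries therefore needs one of two rare events (`full_progress_cases`).

Jump: at the first violation the query correlates by more than `α` with a column `j ≥ p`, `p` being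
the level, although it depends only on the first `p` columns. Instead of conditioning, Haar measure
is averaged over finitely many right rotations that fix those columns and turn column `j` into
normalized sign vectors. Hoeffding's inequality bounds this by `2 exp(-α²(d - T)/2)` for each time
and each `j` (`stiefelUniform_jump_le`), and the assumption on `d` pays for the union bound.

Level `T`: for fixed `U`, the set of hit times determines the first `T` values of `π`, so at most
`(n choose T) (N - T)!` permutations are possible (`card_level_eq_le`), which is at most `δ/2 · N!`
(`choose_mul_factorial_le`). -/

theorem prog_le_iff {T : ℕ} {α : ℝ} {v : EuclideanSpace ℝ (Fin T)} {k : ℕ} :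
    prog α v ≤ k ↔ ∀ j : Fin T, α < |v j| → (j : ℕ) < k := by
  simp [prog, Finset.sup_le_iff]

/-! ### Pullbacks, truncations and what one response reveals -/

theorem pullback_apply {d T : ℕ} (U : Stiefel d T) (x : EuclideanSpace ℝ (Fin d)) (j : Fin T) :
    pullback U x j = ∑ a, U.1 a j * x a := by
  simp [pullback, Matrix.mulVec, dotProduct]

theorem pullback_apply_congr {d T : ℕ} {U U' : Stiefel d T} {j : Fin T}
    (h : ∀ a, U.1 a j = U'.1 a j) (x : EuclideanSpace ℝ (Fin d)) :
    pullback U x j = pullback U' x j := by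
  simp [pullback_apply, h]

theorem continuous_pullbackBall {d T : ℕ} (U : Stiefel d T) : Continuous (pullbackBall U) := by
  refine Continuous.subtype_mk ?_ _
  refine (PiLp.continuous_toLp 2 _).comp ?_
  refine continuous_pi fun j => ?_
  simp only [Matrix.mulVec, dotProduct]
  fun_prop

theorem truncBall_pullbackBall_congr {d T : ℕ} {U U' : Stiefel d T} {k : ℕ}
    (h : ∀ j : Fin T, (j : ℕ) < k → ∀ a, U.1 a j = U'.1 a j) (x : UnitBall d) :
    truncBall k (pullbackBall U x) = truncBall k (pullbackBall U' x) := by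
  refine Subtype.ext ?_
  ext j
  by_cases hj : (j : ℕ) < k
  · simpa [truncBall, trunc, pullbackBall, hj] using pullback_apply_congr (h j hj) x.1
  · simp [truncBall, trunc, hj]

/-- A query at a point of progress at most `k` reveals only the first `k` columns of `U` and the
first `k` values of `π`, unless its index is the next value of `π`, in which case it also reveals
one more column. -/
theorem response_eq {N T d k : ℕ} {α : ℝ} {f : Fin N → UnitBall T → ℝ}
    (hf : IsRobustZeroChain α f) {R : Type*} (O : LocalOracle (UnitBall d) R)
    {π π' : Equiv.Perm (Fin N)} {U U' : Stiefel d T} {i : Fin N} {x : UnitBall d}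
    (hp : prog α (pullback U x.1) ≤ k) (hp' : prog α (pullback U' x.1) ≤ k)
    (hU : ∀ j : Fin T, (j : ℕ) < k → ∀ a, U.1 a j = U'.1 a j)
    (hπ : ((π.symm i : ℕ) < k ∨ (π'.symm i : ℕ) < k) → π.symm i = π'.symm i)
    (hhit : (π.symm i : ℕ) = k ↔ (π'.symm i : ℕ) = k)
    (hhitU : (π.symm i : ℕ) = k → ∀ j : Fin T, (j : ℕ) < k + 1 → ∀ a, U.1 a j = U'.1 a j) :
    O.response (randomizedInstance f π U i) x = O.response (randomizedInstance f π' U' i) x := by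
  refine O.isLocal _ _ _ ?_
  filter_upwards [(continuous_pullbackBall U).continuousAt.eventually (hf (pullbackBall U x)),
    (continuous_pullbackBall U').continuousAt.eventually (hf (pullbackBall U' x))] with y hy hy'
  have hk := hy (π.symm i) k hp
  have hk' := hy' (π'.symm i) k hp'
  simp only [randomizedInstance]
  rcases lt_trichotomy (π.symm i : ℕ) k with h | h | h
  · have e := hπ (.inl h)
    rw [hk.1 (by omega), hk'.1 (by rw [← e]; omega), e, truncBall_pullbackBall_congr hU]
  · have e : π.symm i = π'.symm i := Fin.ext (h.trans (hhit.1 h).symm)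
    rw [hk.2.1 (by omega), hk'.2.1 (by rw [← e]; omega), e,
      truncBall_pullbackBall_congr (hhitU h)]
  -- Beyond `k` both functions are locally the last element of the chain after truncation, so the
  -- two indices need not agree.
  · have h' : k < (π'.symm i : ℕ) := by
      by_contra hc
      rcases (not_lt.1 hc).lt_or_eq with hc | hc
      · have := hπ (.inr hc)
        rw [this] at h
        omega
      · have := hhit.2 hc
        omega
    rw [hk.2.2 (by omega), hk'.2.2 (by omega), truncBall_pullbackBall_congr hU]

/-! ### Levels and hit times -/

/-- The number of initial values of `π` (at most `T`) that have been queried in order: it increases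
at time `t` exactly if the index `i t` is the next value of `π`. -/
def level {N : ℕ} (T : ℕ) (π : Equiv.Perm (Fin N)) (i : ℕ → Fin N) : ℕ → ℕ
  | 0 => 0
  | t + 1 => if level T π i t < T ∧ (π.symm (i t) : ℕ) = level T π i t then level T π i t + 1
      else level T π i t

section level
variable {N : ℕ} (T : ℕ) (π : Equiv.Perm (Fin N)) (i : ℕ → Fin N)

theorem level_succ (t : ℕ) : level T π i (t + 1) =
    if level T π i t < T ∧ (π.symm (i t) : ℕ) = level T π i t then level T π i t + 1
      else level T π i t := rfl

theorem level_mono : Monotone (level T π i) :=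
  monotone_nat_of_le_succ fun t => by rw [level_succ]; split_ifs <;> omega

theorem level_le (t : ℕ) : level T π i t ≤ T := by
  induction t with
  | zero => exact Nat.zero_le _
  | succ t ih => rw [level_succ]; split_ifs <;> omega

/-- The times before `t` at which the level increases. -/
def hits (t : ℕ) : Finset ℕ :=
  (Finset.range t).filter fun s => level T π i s < T ∧ (π.symm (i s) : ℕ) = level T π i s

theorem card_hits (t : ℕ) : (hits T π i t).card = level T π i t := by
  induction t with
  | zero => rfl
  | succ t ih =>
    rw [hits, Finset.range_add_one, Finset.filter_insert, level_succ]
    rw [hits] at ih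
    split_ifs
    · rw [Finset.card_insert_of_notMem (by simp), ih]
    · exact ih

theorem hits_filter {s t : ℕ} (h : s ≤ t) : (hits T π i t).filter (· < s) = hits T π i s := by
  ext r
  simp only [hits, Finset.mem_filter, Finset.mem_range]
  constructor
  · tauto
  · intro hr
    exact ⟨⟨by omega, hr.2⟩, hr.1⟩

/-- A level is the number of earlier hit times. This lets the counting argument encode a whole level
path by one finite set of times. -/
theorem level_eq_of_hits_eq {π π' : Equiv.Perm (Fin N)} {i i' : ℕ → Fin N} {t : ℕ}
    (h : hits T π i t = hits T π' i' t) {s : ℕ} (hs : s ≤ t) :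
    level T π i s = level T π' i' s := by
  rw [← card_hits, ← card_hits, ← hits_filter T π i hs, ← hits_filter T π' i' hs, h]

end level

/-! ### Agreement of controlled runs -/

section run
variable {N T d : ℕ} {α : ℝ} {f : Fin N → UnitBall T → ℝ} {R Z : Type*} [MeasurableSpace R]
  [MeasurableSpace Z] (O : LocalOracle (UnitBall d) R)
  (A : NElementAlgorithm N (UnitBall d) Z R) (ζ : Z)

variable (f) in
/-- The queries on the randomized instance. -/
noncomputable def runQuery (c : Equiv.Perm (Fin N) × Stiefel d T) (t : ℕ) : Fin N × UnitBall d :=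
  A.query O (randomizedInstance f c.1 c.2) ζ t

variable (f) in
/-- The level reached before query `t`. -/
noncomputable def runLevel (c : Equiv.Perm (Fin N) × Stiefel d T) (t : ℕ) : ℕ :=
  level T c.1 (fun s => (runQuery f O A ζ c s).1) t

variable (f α) in
/-- Before time `t` no query had progress beyond its level. -/
def Controlled (c : Equiv.Perm (Fin N) × Stiefel d T) (t : ℕ) : Prop :=
  ∀ s < t, prog α (pullback c.2 (runQuery f O A ζ c s).2.1) ≤ runLevel f O A ζ c s

/-- Controlled runs that share the first `p` columns stay together up to level `p` if they also
share the permutation or the levels. -/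
theorem run_agree (hf : IsRobustZeroChain α f) {π π' : Equiv.Perm (Fin N)} {U U' : Stiefel d T}
    {p t : ℕ} (hc : Controlled α f O A ζ (π, U) t) (hc' : Controlled α f O A ζ (π', U') t)
    (hU : ∀ j : Fin T, (j : ℕ) < p → ∀ a, U.1 a j = U'.1 a j)
    (hp : runLevel f O A ζ (π, U) t ≤ p)
    (h : π = π' ∨ ∀ s ≤ t, runLevel f O A ζ (π, U) s = runLevel f O A ζ (π', U') s) :
    runLevel f O A ζ (π, U) t = runLevel f O A ζ (π', U') t ∧
    (∀ j : Fin N, (j : ℕ) < runLevel f O A ζ (π, U) t → π j = π' j) ∧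
    (runLevel f O A ζ (π, U) t < T →
      A.history O (randomizedInstance f π U) ζ t = A.history O (randomizedInstance f π' U') ζ t) := by
  induction t with
  | zero => exact ⟨rfl, fun j hj => absurd hj (Nat.not_lt_zero _), fun _ => rfl⟩
  | succ t ih =>
    have hmono : runLevel f O A ζ (π, U) t ≤ runLevel f O A ζ (π, U) (t + 1) :=
      level_mono _ _ _ t.le_succ
    obtain ⟨e1, e2, e3⟩ := ih (fun s hs => hc s (by omega)) (fun s hs => hc' s (by omega))
      (hmono.trans hp) (h.imp id fun h s hs => h s (by omega))
    have hle : runLevel f O A ζ (π, U) t ≤ T := level_le _ _ _ _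
    have hs : runLevel f O A ζ (π, U) (t + 1) =
      if runLevel f O A ζ (π, U) t < T ∧ (π.symm (runQuery f O A ζ (π, U) t).1 : ℕ) =
        runLevel f O A ζ (π, U) t then runLevel f O A ζ (π, U) t + 1
      else runLevel f O A ζ (π, U) t := rfl
    have hs' : runLevel f O A ζ (π', U') (t + 1) =
      if runLevel f O A ζ (π', U') t < T ∧ (π'.symm (runQuery f O A ζ (π', U') t).1 : ℕ) =
        runLevel f O A ζ (π', U') t then runLevel f O A ζ (π', U') t + 1
      else runLevel f O A ζ (π', U') t := rfl
    rcases hle.lt_or_eq with hlt | heq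
    · have hq : runQuery f O A ζ (π, U) t = runQuery f O A ζ (π', U') t := by
        simp only [runQuery, NElementAlgorithm.query]
        rw [e3 hlt]
      rw [← e1, ← hq] at hs'
      have hlev : runLevel f O A ζ (π, U) (t + 1) = runLevel f O A ζ (π', U') (t + 1) := by
        -- The first alternative serves the jumps (`π` fixed, `U` rotated), the second the counting
        -- (`U` fixed, `π` varying).
        rcases h with rfl | h
        · rw [hs, hs']
        · exact h _ le_rfl
      have hhit : (π.symm (runQuery f O A ζ (π, U) t).1 : ℕ) = runLevel f O A ζ (π, U) t ↔
          (π'.symm (runQuery f O A ζ (π, U) t).1 : ℕ) = runLevel f O A ζ (π, U) t := by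
        rw [hs, hs'] at hlev
        simp only [hlt, true_and] at hlev
        split_ifs at hlev with h1 h2 h2
        · exact iff_of_true h1 h2
        · omega
        · omega
        · exact iff_of_false h1 h2
      have hsymm : ∀ i : Fin N, ((π.symm i : ℕ) < runLevel f O A ζ (π, U) t ∨
          (π'.symm i : ℕ) < runLevel f O A ζ (π, U) t) → π.symm i = π'.symm i := by
        rintro i (hi | hi)
        · have := e2 _ hi
          rw [Equiv.apply_symm_apply] at this
          rw [Equiv.eq_symm_apply, ← this]
        · have := e2 _ hi
          rw [Equiv.apply_symm_apply] at this
          rw [Equiv.symm_apply_eq, this]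
      refine ⟨hlev, ?_, fun _ => ?_⟩
      · intro j hj
        by_cases hjt : (j : ℕ) < runLevel f O A ζ (π, U) t
        · exact e2 j hjt
        · rw [hs] at hj
          split_ifs at hj with hh
          · have hjk : (j : ℕ) = runLevel f O A ζ (π, U) t := by omega
            have h1 : π.symm (runQuery f O A ζ (π, U) t).1 = j := Fin.ext (hh.2.trans hjk.symm)
            have h2 : π'.symm (runQuery f O A ζ (π, U) t).1 = j :=
              Fin.ext ((hhit.1 hh.2).trans hjk.symm)
            rw [Equiv.symm_apply_eq] at h1 h2
            rw [← h1, ← h2]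
          · omega
      -- A hit reveals one more column, but it also raises the level, which stays at most `p`; so
      -- that column is shared too.
      · have hresp := response_eq hf O (hc t t.lt_succ_self)
          (by rw [hq, e1]; exact hc' t t.lt_succ_self)
          (fun j hj => hU j (by omega)) (hsymm _) hhit
          (fun hh j hj => hU j (by
            rw [if_pos ⟨hlt, hh⟩] at hs
            omega))
        simp only [NElementAlgorithm.history]
        simp only [runQuery, NElementAlgorithm.query] at hresp
        rw [hresp, e3 hlt]
    -- At level `T` the level is frozen, while later responses may still reveal `π T`; hence
    -- histories are compared only below level `T`.
    · have hfix : runLevel f O A ζ (π, U) (t + 1) = runLevel f O A ζ (π, U) t := by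
        rw [hs, if_neg (by omega)]
      have hfix' : runLevel f O A ζ (π', U') (t + 1) = runLevel f O A ζ (π', U') t := by
        rw [hs', if_neg (by omega)]
      rw [hfix, hfix']
      exact ⟨e1, e2, fun hlt => absurd hlt (by omega)⟩

end run

/-! ### Hoeffding's inequality by counting signs -/

theorem sum_exp_signs {d : ℕ} (a : Fin d → ℝ) :
    ∑ ε : Fin d → Bool, Real.exp (∑ i, a i * (if ε i then 1 else -1)) =
      2 ^ d * ∏ i, Real.cosh (a i) := by
  have : ∀ i, 2 * Real.cosh (a i) = ∑ b : Bool, Real.exp (a i * (if b then 1 else -1)) := by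
    intro i
    simp [Real.cosh_eq]
    ring
  have h2 : (2 : ℝ) ^ d * ∏ i, Real.cosh (a i) = ∏ i, (2 * Real.cosh (a i)) := by
    rw [Finset.prod_mul_distrib]; simp
  rw [h2, Finset.prod_congr rfl fun i _ => this i, Finset.prod_univ_sum, Fintype.piFinset_univ]
  exact Finset.sum_congr rfl fun ε _ => Real.exp_sum _ _

/-- Chernoff's bound with `cosh u ≤ exp (u² / 2)`; the parameter `s * r` minimizes `l² / (2r) - l s`
for `r > 0`. The product form of `ha` avoids division, so `r = 0` (the case `d = T`) is allowed. -/
theorem card_signs_lt_sum {d : ℕ} (a : Fin d → ℝ) {r s : ℝ} (hs : 0 ≤ s) (hr : 0 ≤ r)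
    (ha : r * ∑ i, a i ^ 2 ≤ 1) :
    ((Finset.univ.filter fun ε : Fin d → Bool => s < ∑ i, a i * (if ε i then 1 else -1)).card : ℝ)
      ≤ 2 ^ d * Real.exp (-(s ^ 2 * r / 2)) := by
  set l := s * r with hl
  have hl0 : 0 ≤ l := mul_nonneg hs hr
  have h1 := sum_exp_signs fun i => l * a i
  have h2 : ∏ i, Real.cosh (l * a i) ≤ Real.exp (s ^ 2 * r / 2) := by
    calc ∏ i, Real.cosh (l * a i) ≤ ∏ i, Real.exp ((l * a i) ^ 2 / 2) :=
          Finset.prod_le_prod (fun i _ => (Real.cosh_pos _).le)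
            fun i _ => Real.cosh_le_exp_half_sq _
      _ = Real.exp (s ^ 2 * r / 2 * (r * ∑ i, a i ^ 2)) := by
          rw [← Real.exp_sum, Finset.mul_sum, Finset.mul_sum]
          congr 1
          refine Finset.sum_congr rfl fun i _ => ?_
          rw [hl]; ring
      _ ≤ _ := Real.exp_le_exp.2 (mul_le_of_le_one_right (by positivity) ha)
  have h3 : ((Finset.univ.filter fun ε : Fin d → Bool =>
      s < ∑ i, a i * (if ε i then 1 else -1)).card : ℝ) * Real.exp (l * s) ≤
      ∑ ε : Fin d → Bool, Real.exp (∑ i, l * a i * (if ε i then 1 else -1)) := by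
    rw [← nsmul_eq_mul]
    refine (Finset.card_nsmul_le_sum _ _ _ fun ε hε => ?_).trans
      (Finset.sum_le_sum_of_subset_of_nonneg (Finset.filter_subset _ _)
        fun _ _ _ => (Real.exp_pos _).le)
    refine Real.exp_le_exp.2 ?_
    simp only [mul_assoc, ← Finset.mul_sum]
    exact mul_le_mul_of_nonneg_left (Finset.mem_filter.1 hε).2.le hl0
  rw [h1] at h3
  have h4 := h3.trans (mul_le_mul_of_nonneg_left h2 (by positivity))
  rw [← le_div_iff₀ (Real.exp_pos _), mul_div_assoc, ← Real.exp_sub] at h4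
  have h5 : s ^ 2 * r / 2 - l * s = -(s ^ 2 * r / 2) := by rw [hl]; ring
  rwa [h5] at h4

/-- Hoeffding's inequality for random signs. -/
theorem card_signs_lt_abs_sum {d : ℕ} (a : Fin d → ℝ) {r s : ℝ} (hs : 0 ≤ s) (hr : 0 ≤ r)
    (ha : r * ∑ i, a i ^ 2 ≤ 1) :
    ((Finset.univ.filter fun ε : Fin d → Bool =>
      s < |∑ i, a i * (if ε i then 1 else -1)|).card : ℝ)
      ≤ 2 ^ d * (2 * Real.exp (-(s ^ 2 * r / 2))) := by
  have h1 := card_signs_lt_sum a hs hr ha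
  have h2 := card_signs_lt_sum (fun i => -a i) hs hr (by simpa using ha)
  have h3 : (Finset.univ.filter fun ε : Fin d → Bool =>
      s < |∑ i, a i * (if ε i then 1 else -1)|) ⊆
      (Finset.univ.filter fun ε : Fin d → Bool => s < ∑ i, a i * (if ε i then 1 else -1)) ∪
      (Finset.univ.filter fun ε : Fin d → Bool => s < ∑ i, -a i * (if ε i then 1 else -1)) := by
    intro ε hε
    simp only [Finset.mem_filter, Finset.mem_univ, true_and, Finset.mem_union, neg_mul,
      Finset.sum_neg_distrib] at hε ⊢
    exact lt_abs.1 hε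
  have h4 : ((Finset.univ.filter fun ε : Fin d → Bool =>
      s < |∑ i, a i * (if ε i then 1 else -1)|).card : ℝ) ≤ _ :=
    Nat.cast_le.2 ((Finset.card_le_card h3).trans (Finset.card_union_le _ _))
  push_cast at h4
  linarith

/-! ### Rotations with prescribed columns -/

/-- An orthogonal matrix that fixes the first `p` basis vectors and maps the basis vector `j` to a
vector that is constant on the other coordinates. -/
theorem exists_orthogonal_flat_column {d p : ℕ} (hpd : p < d) (j : Fin d) (hj : p ≤ (j : ℕ)) :
    ∃ W : Matrix (Fin d) (Fin d) ℝ, W ∈ Matrix.orthogonalGroup (Fin d) ℝ ∧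
      (∀ k : Fin d, (k : ℕ) < p → ∀ i, W i k = if i = k then 1 else 0) ∧
      ∀ i, W i j = if (i : ℕ) < p then 0 else (√((d : ℝ) - p))⁻¹ := by
  classical
  have hn : (0 : ℝ) < (d : ℝ) - p := sub_pos.2 (Nat.cast_lt.2 hpd)
  let w : EuclideanSpace ℝ (Fin d) :=
    WithLp.toLp 2 fun i => if (i : ℕ) < p then 0 else (√((d : ℝ) - p))⁻¹
  let v : Fin d → EuclideanSpace ℝ (Fin d) :=
    fun k => if (k : ℕ) < p then EuclideanSpace.single k 1 else w
  let s : Set (Fin d) := {k | (k : ℕ) < p ∨ k = j}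
  have hcard : (Finset.univ.filter fun i : Fin d => ¬ (i : ℕ) < p).card = d - p := by
    have h1 := Finset.card_filter_add_card_filter_not (s := (Finset.univ : Finset (Fin d)))
      (fun i : Fin d => (i : ℕ) < p)
    rw [Fin.card_filter_val_lt, Finset.card_univ, Fintype.card_fin] at h1
    omega
  have hw : inner ℝ w w = 1 := by
    simp only [PiLp.inner_apply, w, RCLike.inner_apply, conj_trivial]
    have : ∀ i : Fin d, ((if (i : ℕ) < p then (0 : ℝ) else (√((d : ℝ) - p))⁻¹) *
        (if (i : ℕ) < p then 0 else (√((d : ℝ) - p))⁻¹)) =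
        if ¬ (i : ℕ) < p then ((d : ℝ) - p)⁻¹ else 0 := by
      intro i
      by_cases h : (i : ℕ) < p
      · simp [h]
      · simp only [h, if_false, not_false_eq_true, if_true]
        rw [← mul_inv, Real.mul_self_sqrt hn.le]
    rw [Finset.sum_congr rfl fun i _ => this i, ← Finset.sum_filter, Finset.sum_const, hcard,
      nsmul_eq_mul, Nat.cast_sub hpd.le, mul_inv_cancel₀ hn.ne']
  have hv : Orthonormal ℝ (s.domRestrict v) := by
    rw [orthonormal_iff_ite]
    rintro ⟨k, hk⟩ ⟨l, hl⟩
    simp only [Set.domRestrict_apply, Subtype.mk.injEq, v]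
    rcases hk with hk | rfl <;> rcases hl with hl | rfl
    · simp [hk, hl, PiLp.inner_apply]
    · have hne : k ≠ l := by rintro rfl; omega
      simp [hk, hj.not_gt, hne, w, EuclideanSpace.inner_single_left]
    · have hne : k ≠ l := by rintro rfl; omega
      simp [hl, hj.not_gt, hne, w, EuclideanSpace.inner_single_right]
    · simp only [hj.not_gt, if_false, if_true, hw]
  obtain ⟨b, hb⟩ := hv.exists_orthonormalBasis_extension_of_card_eq (by simp)
  have hU := (EuclideanSpace.basisFun (Fin d) ℝ).toMatrix_orthonormalBasis_mem_unitary b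
  refine ⟨(EuclideanSpace.basisFun (Fin d) ℝ).toBasis.toMatrix b, hU, ?_, ?_⟩
  · intro k hk i
    rw [Module.Basis.toMatrix_apply, hb k (.inl hk)]
    simp [v, hk]
  · intro i
    rw [Module.Basis.toMatrix_apply, hb j (.inr rfl)]
    simp [v, hj.not_gt, w]

/-- A finite family of orthogonal matrices that fix the first `p` basis vectors and map the
basis vector `j` to the normalized sign vectors on the other coordinates. -/
theorem exists_orthogonal_sign_column {d p : ℕ} (hpd : p < d) (j : Fin d) (hj : p ≤ (j : ℕ)) :
    ∃ W : (Fin d → Bool) → Matrix.orthogonalGroup (Fin d) ℝ,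
      (∀ ε, ∀ k : Fin d, (k : ℕ) < p → ∀ i, (W ε).1 i k = if i = k then 1 else 0) ∧
      ∀ ε i, (W ε).1 i j =
        (if (i : ℕ) < p then 0 else (√((d : ℝ) - p))⁻¹) * (if ε i then 1 else -1) := by
  obtain ⟨W, hW, h1, h2⟩ := exists_orthogonal_flat_column hpd j hj
  -- The first `p` signs are ignored, so that the first `p` basis vectors stay fixed.
  let D : (Fin d → Bool) → Fin d → ℝ := fun ε i => if (i : ℕ) < p then 1 else if ε i then 1 else -1
  have hD : ∀ ε, Matrix.diagonal (D ε) ∈ Matrix.orthogonalGroup (Fin d) ℝ := by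
    intro ε
    rw [Matrix.mem_orthogonalGroup_iff, Matrix.diagonal_transpose,
      Matrix.diagonal_mul_diagonal, ← Matrix.diagonal_one]
    congr 1
    ext i
    simp only [D]
    split_ifs <;> norm_num
  refine ⟨fun ε => ⟨Matrix.diagonal (D ε), hD ε⟩ * ⟨W, hW⟩, ?_, ?_⟩
  · intro ε k hk i
    change (Matrix.diagonal (D ε) * W) i k = _
    rw [Matrix.diagonal_mul, h1 k hk]
    split_ifs with h
    · subst h; simp [D, hk]
    · simp
  · intro ε i
    change (Matrix.diagonal (D ε) * W) i j = _
    rw [Matrix.diagonal_mul, h2]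
    by_cases h : (i : ℕ) < p
    · simp [h]
    · simp [D, h, mul_comm]

/-! ### Invariance of the uniform distribution -/

instance isProbabilityMeasure_haarOrthogonal (d : ℕ) :
    IsProbabilityMeasure (haarOrthogonal d) :=
  ⟨by rw [haarOrthogonal]; exact Measure.haarMeasure_self⟩

/-- Compact groups are unimodular: the pushforward is again left invariant, hence a multiple of Haar
measure, and total mass one fixes the factor. Right multiplication is the side that recombines
columns. -/
theorem haarOrthogonal_map_mul_right {d : ℕ} (W : Matrix.orthogonalGroup (Fin d) ℝ) :
    (haarOrthogonal d).map (· * W) = haarOrthogonal d := by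
  have h1 : IsProbabilityMeasure ((haarOrthogonal d).map (· * W)) :=
    Measure.isProbabilityMeasure_map (measurable_mul_const W).aemeasurable
  have h2 : (haarOrthogonal d).IsHaarMeasure := by rw [haarOrthogonal]; infer_instance
  have h3 : ((haarOrthogonal d).map (· * W)).IsMulLeftInvariant := inferInstance
  have h4 := Measure.isMulInvariant_eq_smul_of_compactSpace ((haarOrthogonal d).map (· * W))
    (haarOrthogonal d)
  have h5 := congrArg (fun μ : Measure (Matrix.orthogonalGroup (Fin d) ℝ) => μ Set.univ) h4
  simp only [Measure.smul_apply, measure_univ] at h5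
  rw [h4]
  have h6 : Measure.haarScalarFactor ((haarOrthogonal d).map (· * W)) (haarOrthogonal d) = 1 := by
    simpa [ENNReal.smul_def] using h5.symm
  rw [h6, one_smul]

theorem measurable_firstColumns {d T : ℕ} (h : T ≤ d) : Measurable (firstColumns h) := by
  refine Measurable.subtype_mk ?_
  refine measurable_pi_lambda _ fun i => measurable_pi_lambda _ fun j => ?_
  have h1 : Measurable fun Q : Matrix.orthogonalGroup (Fin d) ℝ => Q.1 := measurable_subtype_coe
  exact (measurable_pi_apply (Fin.castLE h j)).comp ((measurable_pi_apply i).comp h1)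

theorem isProbabilityMeasure_stiefelUniform {d T : ℕ} (h : T ≤ d) :
    IsProbabilityMeasure (stiefelUniform d T) := by
  rw [stiefelUniform, dif_pos h]
  exact Measure.isProbabilityMeasure_map (measurable_firstColumns h).aemeasurable

/-- Averaging over finitely many rotations. -/
theorem stiefelUniform_apply_eq_lintegral {d T : ℕ} (h : T ≤ d) {ι : Type*} [Fintype ι] [Nonempty ι]
    (W : ι → Matrix.orthogonalGroup (Fin d) ℝ) {s : Set (Stiefel d T)} (hs : MeasurableSet s) :
    stiefelUniform d T s = ∫⁻ Q, (∑ ε, s.indicator 1 (firstColumns h (Q * W ε))) /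
      (Fintype.card ι : ENNReal) ∂(haarOrthogonal d) := by
  have hm : ∀ ε, Measurable fun Q : Matrix.orthogonalGroup (Fin d) ℝ =>
      s.indicator (1 : Stiefel d T → ENNReal) (firstColumns h (Q * W ε)) := fun ε =>
    (measurable_one.indicator hs).comp
      ((measurable_firstColumns h).comp (measurable_mul_const (W ε)))
  have h1 : ∀ ε, ∫⁻ Q, s.indicator (1 : Stiefel d T → ENNReal) (firstColumns h (Q * W ε))
      ∂(haarOrthogonal d) = stiefelUniform d T s := by
    intro ε
    rw [← lintegral_map (f := fun Q => s.indicator (1 : Stiefel d T → ENNReal) (firstColumns h Q))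
      ((measurable_one.indicator hs).comp (measurable_firstColumns h)) (measurable_mul_const (W ε)),
      haarOrthogonal_map_mul_right, stiefelUniform, dif_pos h,
      ← lintegral_map (measurable_one.indicator hs) (measurable_firstColumns h),
      lintegral_indicator_one hs]
  simp only [div_eq_mul_inv]
  rw [lintegral_mul_const _ (Finset.measurable_sum _ fun ε _ => hm ε),
    lintegral_finsetSum _ fun ε _ => hm ε, Finset.sum_congr rfl fun ε _ => h1 ε, Finset.sum_const,
    Finset.card_univ, nsmul_eq_mul, mul_right_comm,
    ENNReal.mul_inv_cancel (by simp) (ENNReal.natCast_ne_top _), one_mul]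

/-! ### Measurability -/

theorem measurable_pullback_apply {d T : ℕ} (j : Fin T) :
    Measurable fun c : Stiefel d T × EuclideanSpace ℝ (Fin d) => pullback c.1 c.2 j := by
  simp only [pullback_apply]
  refine Finset.measurable_sum _ fun a _ => Measurable.mul ?_ ?_
  · have h1 : Measurable fun c : Stiefel d T × EuclideanSpace ℝ (Fin d) => c.1.1 :=
      measurable_subtype_coe.comp measurable_fst
    exact (measurable_pi_apply j).comp ((measurable_pi_apply a).comp h1)
  · have h1 : Measurable fun x : EuclideanSpace ℝ (Fin d) => x a := by fun_prop
    exact h1.comp measurable_snd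

theorem measurable_prog_pullback {d T : ℕ} (α : ℝ) :
    Measurable fun c : Stiefel d T × EuclideanSpace ℝ (Fin d) => prog α (pullback c.1 c.2) := by
  refine measurable_of_Iic fun k => ?_
  simp only [Set.preimage, Set.mem_Iic, prog_le_iff, Set.ofPred_forall]
  refine MeasurableSet.iInter fun j => ?_
  by_cases hj : (j : ℕ) < k
  · simp [hj]
  · simp only [hj, imp_false, not_lt]
    exact measurableSet_le (measurable_pullback_apply j).abs measurable_const

section run
variable {N T d : ℕ} {α : ℝ} {f : Fin N → UnitBall T → ℝ} {R Z : Type*} [MeasurableSpace R]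
  [MeasurableSpace Z] {O : LocalOracle (UnitBall d) R}
  {A : NElementAlgorithm N (UnitBall d) Z R} {ζ : Z}

theorem measurable_pullback_runQuery (hq : ∀ t, Measurable fun c => runQuery f O A ζ c t) (t : ℕ) :
    Measurable fun c : Equiv.Perm (Fin N) × Stiefel d T =>
      (c.2, (runQuery f O A ζ c t).2.1) :=
  measurable_snd.prodMk (measurable_subtype_coe.comp (measurable_snd.comp (hq t)))

theorem measurable_runLevel (hq : ∀ t, Measurable fun c => runQuery f O A ζ c t) (t : ℕ) :
    Measurable fun c => runLevel f O A ζ c t := by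
  induction t with
  | zero => exact measurable_const
  | succ t ih =>
    have h1 : Measurable fun p : Equiv.Perm (Fin N) × Fin N => (p.1.symm p.2 : ℕ) :=
      Measurable.of_discrete
    have h2 : Measurable fun c : Equiv.Perm (Fin N) × Stiefel d T =>
        (c.1.symm (runQuery f O A ζ c t).1 : ℕ) :=
      h1.comp (measurable_fst.prodMk (measurable_fst.comp (hq t)))
    exact Measurable.ite ((measurableSet_lt ih measurable_const).inter (measurableSet_eq_fun h2 ih))
      (ih.add_const 1) ih

theorem measurableSet_controlled (hq : ∀ t, Measurable fun c => runQuery f O A ζ c t) (t : ℕ) :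
    MeasurableSet {c | Controlled α f O A ζ c t} := by
  have h1 : ∀ s, MeasurableSet {c : Equiv.Perm (Fin N) × Stiefel d T |
      prog α (pullback c.2 (runQuery f O A ζ c s).2.1) ≤ runLevel f O A ζ c s} := by
    intro s
    have h2 : Measurable fun c : Equiv.Perm (Fin N) × Stiefel d T =>
        prog α (pullback c.2 (runQuery f O A ζ c s).2.1) := by
      have h4 := (measurable_prog_pullback (d := d) (T := T) α).comp
        (measurable_pullback_runQuery hq s)
      exact h4
    have h4 := measurable_runLevel hq s
    exact measurableSet_le h2 h4
  have h3 : {c | Controlled α f O A ζ c t} = ⋂ s ∈ Set.Iio t, {c : Equiv.Perm (Fin N) × Stiefel d T |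
      prog α (pullback c.2 (runQuery f O A ζ c s).2.1) ≤ runLevel f O A ζ c s} := by
    ext c
    simp [Controlled]
  rw [h3]
  exact MeasurableSet.biInter (Set.to_countable _) fun s _ => h1 s

/-! ### Jumps are unlikely -/

variable (α f O A ζ) in
/-- The run is controlled before time `t`, has reached level `p`, and its query has a large
coordinate `j`. -/
def Jump (t p : ℕ) (j : Fin T) : Set (Equiv.Perm (Fin N) × Stiefel d T) :=
  {c | Controlled α f O A ζ c t ∧ runLevel f O A ζ c t = p ∧
    α < |pullback c.2 (runQuery f O A ζ c t).2.1 j|}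

theorem measurableSet_jump (hq : ∀ t, Measurable fun c => runQuery f O A ζ c t) (t p : ℕ)
    (j : Fin T) : MeasurableSet (Jump α f O A ζ t p j) :=
  (measurableSet_controlled hq t).inter
    ((measurableSet_eq_fun (measurable_runLevel hq t) measurable_const).inter
      (measurableSet_lt measurable_const
        (((measurable_pullback_apply j).comp (measurable_pullback_runQuery hq t)).abs)))

theorem sum_sq_orthogonal_le {d : ℕ} (Q : Matrix.orthogonalGroup (Fin d) ℝ) (x : UnitBall d) :
    ∑ i, (∑ a, Q.1 a i * x.1 a) ^ 2 ≤ 1 := by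
  have h1 := (norm_pullback_le (firstColumns le_rfl Q) x.1).trans (mem_closedBall_zero_iff.1 x.2)
  have h2 := pow_le_one₀ (n := 2) (norm_nonneg _) h1
  rw [EuclideanSpace.norm_sq_eq] at h2
  simpa [pullback_apply, firstColumns] using h2

theorem pullback_firstColumns_mul {d T : ℕ} (h : T ≤ d) (Q W : Matrix.orthogonalGroup (Fin d) ℝ)
    (x : EuclideanSpace ℝ (Fin d)) (j : Fin T) :
    pullback (firstColumns h (Q * W)) x j =
      ∑ i, (∑ a, Q.1 a i * x a) * W.1 i (Fin.castLE h j) := by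
  rw [pullback_apply]
  simp only [firstColumns, Matrix.submatrix_apply, id, Matrix.UnitaryGroup.mul_val,
    Matrix.mul_apply, Finset.sum_mul]
  rw [Finset.sum_comm]
  exact Finset.sum_congr rfl fun i _ => Finset.sum_congr rfl fun a _ => by ring

/-- Rotations of the last columns that make a jump in coordinate `j` unlikely. -/
theorem sum_indicator_jump_le (hf : IsRobustZeroChain α f) (hα : 0 ≤ α) (h : T ≤ d) (j : Fin T)
    {W : ℕ → (Fin d → Bool) → Matrix.orthogonalGroup (Fin d) ℝ}
    (hW1 : ∀ p ≤ (j : ℕ), ∀ ε, ∀ k : Fin d, (k : ℕ) < p → ∀ i, (W p ε).1 i k = if i = k then 1 else 0)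
    (hW2 : ∀ p ≤ (j : ℕ), ∀ ε i, (W p ε).1 i (Fin.castLE h j) =
        (if (i : ℕ) < p then 0 else (√((d : ℝ) - p))⁻¹) * (if ε i then 1 else -1))
    (π : Equiv.Perm (Fin N)) (t : ℕ) (Q : Matrix.orthogonalGroup (Fin d) ℝ) :
    ∑ p ∈ Finset.range (j + 1), (∑ ε, (Prod.mk π ⁻¹' Jump α f O A ζ t p j).indicator
      (1 : Stiefel d T → ENNReal) (firstColumns h (Q * W p ε))) /
        (Fintype.card (Fin d → Bool) : ENNReal) ≤
      ENNReal.ofReal (2 * Real.exp (-(α ^ 2 * ((d : ℝ) - T) / 2))) := by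
  by_cases hex : ∃ p ≤ (j : ℕ), ∃ ε, (π, firstColumns h (Q * W p ε)) ∈ Jump α f O A ζ t p j
  swap
  · push Not at hex
    rw [Finset.sum_eq_zero]
    · exact zero_le
    · intro p hp
      rw [Finset.sum_eq_zero, ENNReal.zero_div]
      exact fun ε _ => Set.indicator_of_notMem (s := Prod.mk π ⁻¹' _)
        (hex p (Nat.lt_succ_iff.1 (Finset.mem_range.1 hp)) ε) _
  obtain ⟨p, hp, ε₀, hε₀⟩ := hex
  have hcol : ∀ p ≤ (j : ℕ), ∀ ε, ∀ k : Fin T, (k : ℕ) < p → ∀ a,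
      (firstColumns h (Q * W p ε)).1 a k = Q.1 a (Fin.castLE h k) := by
    intro p hp ε k hk a
    simp [firstColumns, Matrix.mul_apply, hW1 p hp ε (Fin.castLE h k) (by simpa using hk)]
  -- Two jumping rotations share the first `min p p'` columns, so their runs have the same level and
  -- the same query. Hence a single `p` contributes to the sum, and the query point does not depend
  -- on the signs.
  have hagree : ∀ p' ≤ (j : ℕ), ∀ ε, (π, firstColumns h (Q * W p' ε)) ∈ Jump α f O A ζ t p' j →
      p' = p ∧ runQuery f O A ζ (π, firstColumns h (Q * W p' ε)) t =
        runQuery f O A ζ (π, firstColumns h (Q * W p ε₀)) t := by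
    intro p' hp' ε hε
    have hjT := j.2
    rcases le_total p p' with hle | hle
    · obtain ⟨e1, -, e3⟩ := run_agree O A ζ hf hε₀.1 hε.1 (p := p)
        (fun k hk a => by rw [hcol p hp _ k hk, hcol p' hp' _ k (by omega)])
        hε₀.2.1.le (.inl rfl)
      rw [hε₀.2.1, hε.2.1] at e1
      refine ⟨e1.symm, ?_⟩
      simp only [runQuery, NElementAlgorithm.query]
      rw [e3 (by rw [hε₀.2.1]; omega)]
    · obtain ⟨e1, -, e3⟩ := run_agree O A ζ hf hε.1 hε₀.1 (p := p')
        (fun k hk a => by rw [hcol p hp _ k (by omega), hcol p' hp' _ k hk])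
        hε.2.1.le (.inl rfl)
      rw [hε₀.2.1, hε.2.1] at e1
      refine ⟨e1, ?_⟩
      simp only [runQuery, NElementAlgorithm.query]
      rw [e3 (by rw [hε.2.1]; omega)]
  set x := (runQuery f O A ζ (π, firstColumns h (Q * W p ε₀)) t).2 with hx
  have hpd : p < d := by have := j.2; omega
  have hn : (0 : ℝ) < (d : ℝ) - p := sub_pos.2 (Nat.cast_lt.2 hpd)
  rw [Finset.sum_eq_single_of_mem p (Finset.mem_range.2 (by omega))]
  swap
  · intro p' hp' hne
    rw [Finset.sum_eq_zero, ENNReal.zero_div]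
    exact fun ε _ => Set.indicator_of_notMem (s := Prod.mk π ⁻¹' _)
      (fun hmem => hne (hagree p' (Nat.lt_succ_iff.1 (Finset.mem_range.1 hp')) ε hmem).1) _
  -- Coefficients of the signs in the inner product of column `j` with the query; since `Q` is
  -- orthogonal, their squares sum to at most `1 / (d - p)`.
  let a : Fin d → ℝ := fun i =>
    (∑ b, Q.1 b i * x.1 b) * (if (i : ℕ) < p then 0 else (√((d : ℝ) - p))⁻¹)
  have ha : ((d : ℝ) - T) * ∑ i, a i ^ 2 ≤ 1 := by
    have h1 : ∑ i, a i ^ 2 ≤ ((d : ℝ) - p)⁻¹ := by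
      calc ∑ i, a i ^ 2 ≤ ∑ i, (∑ b, Q.1 b i * x.1 b) ^ 2 * ((d : ℝ) - p)⁻¹ := by
            refine Finset.sum_le_sum fun i _ => ?_
            simp only [a, mul_pow]
            refine mul_le_mul_of_nonneg_left ?_ (sq_nonneg _)
            split_ifs
            · simpa using hn.le
            · rw [inv_pow, Real.sq_sqrt hn.le]
        _ = (∑ i, (∑ b, Q.1 b i * x.1 b) ^ 2) * ((d : ℝ) - p)⁻¹ := by rw [Finset.sum_mul]
        _ ≤ _ := mul_le_of_le_one_left (inv_nonneg.2 hn.le) (sum_sq_orthogonal_le Q x)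
    have h2 : (d : ℝ) - T ≤ d - p := by
      have : (p : ℝ) ≤ T := by exact_mod_cast hp.trans j.2.le
      linarith
    calc ((d : ℝ) - T) * ∑ i, a i ^ 2 ≤ (d - p) * ((d : ℝ) - p)⁻¹ :=
          mul_le_mul h2 h1 (Finset.sum_nonneg fun i _ => sq_nonneg _) hn.le
      _ = 1 := mul_inv_cancel₀ hn.ne'
  have hsub : (∑ ε, (Prod.mk π ⁻¹' Jump α f O A ζ t p j).indicator
      (1 : Stiefel d T → ENNReal) (firstColumns h (Q * W p ε))) ≤
      ((Finset.univ.filter fun ε : Fin d → Bool =>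
        α < |∑ i, a i * (if ε i then 1 else -1)|).card : ENNReal) := by
    rw [Finset.card_filter, Nat.cast_sum]
    refine Finset.sum_le_sum fun ε _ => ?_
    by_cases hmem : (π, firstColumns h (Q * W p ε)) ∈ Jump α f O A ζ t p j
    · have h1 := hmem.2.2
      rw [(hagree p hp ε hmem).2, ← hx, pullback_firstColumns_mul] at h1
      simp only [hW2 p hp, ← mul_assoc] at h1
      rw [if_pos h1]
      exact (Set.indicator_le_self' (fun _ _ => zero_le) _).trans (by simp)
    · rw [Set.indicator_of_notMem (s := Prod.mk π ⁻¹' _) hmem]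
      exact zero_le
  refine (ENNReal.div_le_div_right hsub _).trans ?_
  have hcard := card_signs_lt_abs_sum a hα (sub_nonneg.2 (Nat.cast_le.2 h)) ha
  refine ENNReal.div_le_of_le_mul ?_
  rw [← ENNReal.ofReal_natCast, ← ENNReal.ofReal_natCast, ← ENNReal.ofReal_mul (by positivity)]
  refine ENNReal.ofReal_le_ofReal ?_
  rw [mul_comm]
  simpa using hcard

/-- The union over levels costs no factor: each `p` is averaged over its own rotations, and the sum
over `p` is bounded under the integral, for each `Q`. -/
theorem stiefelUniform_jump_le (hq : ∀ t, Measurable fun c => runQuery f O A ζ c t)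
    (hf : IsRobustZeroChain α f) (hα : 0 ≤ α) (h : T ≤ d) (j : Fin T)
    (π : Equiv.Perm (Fin N)) (t : ℕ) :
    stiefelUniform d T (Prod.mk π ⁻¹' ⋃ p ∈ Finset.range (j + 1), Jump α f O A ζ t p j) ≤
      ENNReal.ofReal (2 * Real.exp (-(α ^ 2 * ((d : ℝ) - T) / 2))) := by
  have hex : ∀ p, ∃ W : (Fin d → Bool) → Matrix.orthogonalGroup (Fin d) ℝ, p ≤ (j : ℕ) →
      (∀ ε, ∀ k : Fin d, (k : ℕ) < p → ∀ i, (W ε).1 i k = if i = k then 1 else 0) ∧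
      ∀ ε i, (W ε).1 i (Fin.castLE h j) =
        (if (i : ℕ) < p then 0 else (√((d : ℝ) - p))⁻¹) * (if ε i then 1 else -1) := by
    intro p
    by_cases hp : p ≤ (j : ℕ)
    · obtain ⟨W, hW⟩ := exists_orthogonal_sign_column (d := d) (p := p)
        (by have := j.2; omega) (Fin.castLE h j) (by simpa using hp)
      exact ⟨W, fun _ => hW⟩
    · exact ⟨fun _ => 1, fun h => absurd h hp⟩
  choose W hW using hex
  have hm : ∀ p, MeasurableSet (Prod.mk π ⁻¹' Jump α f O A ζ t p j) := fun p =>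
    (measurableSet_jump hq t p j).preimage measurable_prodMk_left
  rw [Set.preimage_iUnion₂]
  refine (measure_biUnion_finset_le _ _).trans ?_
  rw [Finset.sum_congr rfl fun p _ => stiefelUniform_apply_eq_lintegral h (W p) (hm p),
    ← lintegral_finsetSum _ fun p _ => ?_]
  · refine (lintegral_mono fun Q => sum_indicator_jump_le hf hα h j (fun p hp => (hW p hp).1)
      (fun p hp => (hW p hp).2) π t Q).trans ?_
    simp
  · refine Measurable.div_const (Finset.measurable_sum _ fun ε _ => ?_) _
    exact (measurable_one.indicator (hm p)).comp
      ((measurable_firstColumns h).comp (measurable_mul_const (W p ε)))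

/-! ### Counting permutations that reach level `T` -/

/-- Composing with `π₀⁻¹` yields permutations that move only the last `N - T` indices. -/
theorem card_perm_agree_le {N T : ℕ} (hT : T ≤ N) (π₀ : Equiv.Perm (Fin N)) :
    (Finset.univ.filter fun π : Equiv.Perm (Fin N) =>
      ∀ j : Fin N, (j : ℕ) < T → π j = π₀ j).card ≤ (N - T).factorial := by
  have h1 : Fintype.card (Equiv.Perm {j : Fin N // ¬ (j : ℕ) < T}) = (N - T).factorial := by
    rw [Fintype.card_perm, Fintype.card_subtype_compl, Fintype.card_fin, Fintype.card_subtype,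
      Fin.card_filter_val_lt, min_eq_right hT]
  rw [← h1, Fintype.card_congr (Equiv.Perm.subtypeEquivSubtypePerm fun j : Fin N => ¬ (j : ℕ) < T),
    Fintype.card_subtype]
  refine Finset.card_le_card_of_injOn (fun π => π₀⁻¹ * π) ?_ fun π _ π' _ h => mul_left_cancel h
  intro π hπ
  simp only [Finset.coe_filter, Finset.mem_univ, true_and, Set.mem_ofPred_eq, not_not] at hπ ⊢
  intro j hj
  simp [hπ j hj]

/-- Few permutations lead a controlled run to the last level within `n` queries. -/
theorem card_level_eq_le (hf : IsRobustZeroChain α f) (hT : T ≤ N) (U : Stiefel d T) (n : ℕ)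
    (s : Finset (Equiv.Perm (Fin N)))
    (hs : ∀ π ∈ s, Controlled α f O A ζ (π, U) n ∧ runLevel f O A ζ (π, U) n = T) :
    s.card ≤ (N - T).factorial * n.choose T := by
  have h1 := Finset.card_le_mul_card_image_of_maps_to
    (s := s) (t := (Finset.range n).powersetCard T)
    (f := fun π => hits T π (fun r => (runQuery f O A ζ (π, U) r).1) n)
    (fun π hπ => Finset.mem_powersetCard.2 ⟨Finset.filter_subset _ _, by
      rw [card_hits]; exact (hs π hπ).2⟩) (N - T).factorial ?_
  · simpa using h1
  -- In the fibre over one set of hit times all levels agree, and `U` is common, so `run_agree`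
  -- forces the first `T` values of `π`.
  intro H _
  rcases Finset.eq_empty_or_nonempty (s.filter fun π =>
    hits T π (fun r => (runQuery f O A ζ (π, U) r).1) n = H) with he | ⟨π₀, hπ₀⟩
  · simp [he]
  refine (Finset.card_le_card fun π hπ => ?_).trans (card_perm_agree_le hT π₀)
  rw [Finset.mem_filter] at hπ hπ₀
  obtain ⟨-, e2, -⟩ := run_agree O A ζ hf (hs π hπ.1).1 (hs π₀ hπ₀.1).1 (p := T)
    (fun _ _ _ => rfl) (hs π hπ.1).2.le
    (.inr fun r hr => level_eq_of_hits_eq T (hπ.2.trans hπ₀.2.symm) hr)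
  rw [(hs π hπ.1).2] at e2
  exact Finset.mem_filter.2 ⟨Finset.mem_univ _, e2⟩

end run

/-! ### Numerical estimates -/

/-- With `x = T - log (2/δ)`, the binomial is at most `(N/16)^T x^T / T! ≤ (N/16)^T e^x`, and `e^x =
e^T δ/2 ≤ 8^T δ/2`. The remaining `(N/2)^T` is at most `N! / (N - T)!` because `T ≤ N/2`. -/
theorem choose_mul_factorial_le {N T n : ℕ} {δ : ℝ} (hδ : 0 < δ) (hTN : (T : ℝ) ≤ (N : ℝ) / 2)
    (hn : (n : ℝ) ≤ 1 / 16 * (N : ℝ) * ((T : ℝ) - Real.log (2 / δ)))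
    (hL : 0 ≤ (T : ℝ) - Real.log (2 / δ)) :
    (((N - T).factorial * n.choose T : ℕ) : ℝ) ≤ δ / 2 * N.factorial := by
  set x := (T : ℝ) - Real.log (2 / δ) with hx
  have hTN' : T ≤ N := by
    have : (T : ℝ) ≤ N := by linarith [(Nat.cast_nonneg T : (0 : ℝ) ≤ T)]
    exact_mod_cast this
  have h1 : (n.choose T : ℝ) ≤ (1 / 16 * (N : ℝ)) ^ T * Real.exp x := by
    calc (n.choose T : ℝ) ≤ (n : ℝ) ^ T / T.factorial := Nat.choose_le_pow_div T n
      _ ≤ (1 / 16 * (N : ℝ) * x) ^ T / T.factorial := by gcongr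
      _ = (1 / 16 * (N : ℝ)) ^ T * (x ^ T / T.factorial) := by rw [mul_pow]; ring
      _ ≤ _ := by gcongr; exact Real.pow_div_factorial_le_exp x hL T
  have h2 : Real.exp x ≤ 8 ^ T * (δ / 2) := by
    rw [hx, Real.exp_sub, Real.exp_log (by positivity), ← Real.exp_one_pow, div_div_eq_mul_div,
      mul_div_assoc]
    gcongr
    linarith [Real.exp_one_lt_d9]
  have h3 : ((N : ℝ) / 2) ^ T ≤ N.descFactorial T := by
    have : (((N + 1 - T) ^ T : ℕ) : ℝ) ≤ N.descFactorial T := by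
      exact_mod_cast Nat.pow_sub_le_descFactorial N T
    refine le_trans ?_ this
    rw [Nat.cast_pow, Nat.cast_sub (by omega)]
    gcongr
    push_cast
    linarith
  have h4 : (n.choose T : ℝ) ≤ δ / 2 * N.descFactorial T := by
    calc (n.choose T : ℝ) ≤ (1 / 16 * (N : ℝ)) ^ T * (8 ^ T * (δ / 2)) :=
          h1.trans (by gcongr)
      _ = δ / 2 * ((N : ℝ) / 2) ^ T := by
          rw [← mul_assoc, ← mul_pow, mul_comm]
          congr 2
          ring
      _ ≤ _ := by gcongr
  rw [← Nat.factorial_mul_descFactorial hTN']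
  push_cast
  calc ((N - T).factorial : ℝ) * n.choose T ≤ (N - T).factorial * (δ / 2 * N.descFactorial T) := by
        gcongr
    _ = _ := by ring

theorem two_mul_exp_le {N T d : ℕ} {α δ : ℝ} (hα : 0 < α) (hδ : 0 < δ) (hN : 0 < N) (hT : 0 < T)
    (hd : (T : ℝ) + 2 / α ^ 2 * Real.log (4 * (N : ℝ) * (T : ℝ) ^ 2 / δ) ≤ (d : ℝ)) :
    2 * Real.exp (-(α ^ 2 * ((d : ℝ) - T) / 2)) ≤ δ / (2 * N * T ^ 2) := by
  have hN' : (0 : ℝ) < N := Nat.cast_pos.2 hN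
  have hT' : (0 : ℝ) < T := Nat.cast_pos.2 hT
  have h1 : Real.log (4 * (N : ℝ) * (T : ℝ) ^ 2 / δ) ≤ α ^ 2 * ((d : ℝ) - T) / 2 := by
    have h2 : 2 / α ^ 2 * Real.log (4 * (N : ℝ) * (T : ℝ) ^ 2 / δ) ≤ d - T := by linarith
    calc Real.log (4 * (N : ℝ) * (T : ℝ) ^ 2 / δ)
        = α ^ 2 * (2 / α ^ 2 * Real.log (4 * (N : ℝ) * (T : ℝ) ^ 2 / δ)) / 2 := by
          field_simp
      _ ≤ _ := by gcongr
  calc 2 * Real.exp (-(α ^ 2 * ((d : ℝ) - T) / 2))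
      ≤ 2 * Real.exp (-Real.log (4 * (N : ℝ) * (T : ℝ) ^ 2 / δ)) := by gcongr
    _ = _ := by
      rw [Real.exp_neg, Real.exp_log (by positivity)]
      field_simp
      norm_num

instance isProbabilityMeasure_permUniform (N : ℕ) : IsProbabilityMeasure (permUniform N) := by
  rw [permUniform]; infer_instance

theorem permUniform_apply_le {N m : ℕ} {δ : ℝ} (s : Set (Equiv.Perm (Fin N)))
    (hs : ∀ u : Finset (Equiv.Perm (Fin N)), (∀ π ∈ u, π ∈ s) → u.card ≤ m)
    (hm : (m : ℝ) ≤ δ * N.factorial) : permUniform N s ≤ ENNReal.ofReal δ := by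
  classical
  rw [permUniform, PMF.toMeasure_uniformOfFintype_apply _ MeasurableSet.of_discrete,
    Fintype.card_perm, Fintype.card_fin]
  refine ENNReal.div_le_of_le_mul ?_
  rw [← ENNReal.ofReal_natCast, ← ENNReal.ofReal_natCast, ← ENNReal.ofReal_mul' (by positivity)]
  refine ENNReal.ofReal_le_ofReal (le_trans ?_ hm)
  rw [← Set.toFinset_card]
  exact_mod_cast hs s.toFinset fun π hπ => Set.mem_toFinset.1 hπ

/-! ### Combining the two failure events -/

section run
variable {N T d : ℕ} {α : ℝ} {f : Fin N → UnitBall T → ℝ} {R Z : Type*} [MeasurableSpace R]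
  [MeasurableSpace Z] {O : LocalOracle (UnitBall d) R}
  {A : NElementAlgorithm N (UnitBall d) Z R} {ζ : Z}

/-- A run that makes full progress within `n` queries either jumps ahead of its level or is
controlled and reaches the last level. -/
theorem full_progress_cases {n : ℕ} {c : Equiv.Perm (Fin N) × Stiefel d T}
    (hc : ∃ t < n, T ≤ prog α (pullback c.2 (runQuery f O A ζ c t).2.1)) :
    (∃ t < n, ∃ j : Fin T, ∃ p < (j : ℕ) + 1, c ∈ Jump α f O A ζ t p j) ∨
      (Controlled α f O A ζ c n ∧ runLevel f O A ζ c n = T) := by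
  classical
  by_cases hn : Controlled α f O A ζ c n
  · refine .inr ⟨hn, le_antisymm (level_le _ _ _ _) ?_⟩
    obtain ⟨t, ht, h⟩ := hc
    exact (h.trans (hn t ht)).trans (level_mono _ _ _ ht.le)
  · left
    have hex : ∃ t, t < n ∧
        ¬ prog α (pullback c.2 (runQuery f O A ζ c t).2.1) ≤ runLevel f O A ζ c t := by
      simpa [Controlled] using hn
    -- Taking the first violation makes the run controlled before it, as `Jump` requires.
    obtain ⟨t, ⟨h1, h2⟩, hmin⟩ : ∃ t, (t < n ∧
        ¬ prog α (pullback c.2 (runQuery f O A ζ c t).2.1) ≤ runLevel f O A ζ c t) ∧ ∀ s < t,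
        ¬ (s < n ∧ ¬ prog α (pullback c.2 (runQuery f O A ζ c s).2.1) ≤ runLevel f O A ζ c s) :=
      ⟨Nat.find hex, Nat.find_spec hex, fun s hs => Nat.find_min hex hs⟩
    rw [prog_le_iff] at h2
    push Not at h2
    obtain ⟨j, hj1, hj2⟩ := h2
    refine ⟨t, h1, j, _, Nat.lt_succ_of_le hj2, fun s hs => ?_, rfl, hj1⟩
    by_contra hcon
    exact hmin s hs ⟨hs.trans h1, hcon⟩

/-- Fubini is used in both orders: jumps are bounded over `U` for each `π`, reaching level `T` over
`π` for each `U`. -/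
theorem measure_full_progress_le (hq : ∀ t, Measurable fun c => runQuery f O A ζ c t)
    (hf : IsRobustZeroChain α f) {δ : ℝ} (hα : 0 < α) (hδ : δ ∈ Set.Ioo (0 : ℝ) 1) (hT : 0 < T)
    (hTN : (T : ℝ) ≤ (N : ℝ) / 2) (hTd : T ≤ d)
    (hd : (T : ℝ) + 2 / α ^ 2 * Real.log (4 * (N : ℝ) * (T : ℝ) ^ 2 / δ) ≤ (d : ℝ)) {n : ℕ}
    (hn : (n : ℝ) ≤ 1 / 16 * (N : ℝ) * ((T : ℝ) - Real.log (2 / δ)))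
    (hL : 0 ≤ (T : ℝ) - Real.log (2 / δ)) :
    ((permUniform N).prod (stiefelUniform d T))
      {c | ∃ t < n, T ≤ prog α (pullback c.2 (runQuery f O A ζ c t).2.1)} ≤ ENNReal.ofReal δ := by
  have hst := isProbabilityMeasure_stiefelUniform hTd
  have hT' : (0 : ℝ) < T := Nat.cast_pos.2 hT
  have hN' : (0 : ℝ) < N := by linarith
  have hN : 0 < N := Nat.cast_pos.1 hN'
  have hTleN : T ≤ N := by
    have : (T : ℝ) ≤ N := by linarith
    exact_mod_cast this
  set b : ℝ := 2 * Real.exp (-(α ^ 2 * ((d : ℝ) - T) / 2)) with hb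
  let E : ℕ → Fin T → Set (Equiv.Perm (Fin N) × Stiefel d T) := fun t j =>
    ⋃ p ∈ Finset.range (j + 1), Jump α f O A ζ t p j
  let G : Set (Equiv.Perm (Fin N) × Stiefel d T) :=
    {c | Controlled α f O A ζ c n ∧ runLevel f O A ζ c n = T}
  have hE : ∀ t j, ((permUniform N).prod (stiefelUniform d T)) (E t j) ≤ ENNReal.ofReal b := by
    intro t j
    rw [Measure.prod_apply (Finset.measurableSet_biUnion _ fun p _ => measurableSet_jump hq t p j)]
    refine (lintegral_mono fun π => stiefelUniform_jump_le hq hf hα.le hTd j π t).trans ?_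
    simp [hb]
  have hG : ((permUniform N).prod (stiefelUniform d T)) G ≤ ENNReal.ofReal (δ / 2) := by
    have hGm : MeasurableSet G := by
      have h1 := measurable_runLevel hq n
      exact (measurableSet_controlled hq n).inter (measurableSet_eq_fun h1 measurable_const)
    rw [Measure.prod_apply_symm hGm]
    refine (lintegral_mono fun U => permUniform_apply_le (δ := δ / 2) _
      (fun u hu => card_level_eq_le hf hTleN U n u hu)
      (choose_mul_factorial_le hδ.1 hTN hn hL)).trans ?_
    simp
  have hsub : {c : Equiv.Perm (Fin N) × Stiefel d T |
      ∃ t < n, T ≤ prog α (pullback c.2 (runQuery f O A ζ c t).2.1)} ⊆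
      (⋃ t ∈ Finset.range n, ⋃ j ∈ (Finset.univ : Finset (Fin T)), E t j) ∪ G := by
    intro c hc
    rcases full_progress_cases hc with ⟨t, ht, j, p, hp, h⟩ | h
    · left
      simp only [Set.mem_iUnion, E]
      exact ⟨t, Finset.mem_range.2 ht, j, Finset.mem_univ _, p, Finset.mem_range.2 hp, h⟩
    · exact .inr h
  have hsum : ((permUniform N).prod (stiefelUniform d T))
      (⋃ t ∈ Finset.range n, ⋃ j ∈ (Finset.univ : Finset (Fin T)), E t j) ≤
      ENNReal.ofReal (n * (T * b)) := by
    refine (measure_biUnion_finset_le _ _).trans ?_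
    refine (Finset.sum_le_card_nsmul _ _ (ENNReal.ofReal (T * b)) fun t _ => ?_).trans ?_
    · refine (measure_biUnion_finset_le _ _).trans ?_
      refine (Finset.sum_le_card_nsmul _ _ _ fun j _ => hE t j).trans ?_
      rw [Finset.card_univ, Fintype.card_fin, nsmul_eq_mul, ENNReal.ofReal_mul hT'.le,
        ENNReal.ofReal_natCast]
    · rw [Finset.card_range, nsmul_eq_mul, ENNReal.ofReal_mul (Nat.cast_nonneg n),
        ENNReal.ofReal_natCast]
  -- There are `n T ≤ N T² / 16` pairs of a time and a coordinate, each costing at most `δ / (2 N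
  -- T²)`.
  have hnum : n * (T * b) ≤ δ / 2 := by
    have hlog : 0 ≤ Real.log (2 / δ) :=
      Real.log_nonneg ((one_le_div hδ.1).2 (by linarith [hδ.2]))
    have hb' := two_mul_exp_le hα hδ.1 hN hT hd
    have hn' : (n : ℝ) ≤ 1 / 16 * N * T := hn.trans (by gcongr; linarith)
    calc n * (T * b) ≤ (1 / 16 * N * T) * (T * (δ / (2 * N * T ^ 2))) := by gcongr
      _ = δ / 32 := by field_simp; ring
      _ ≤ δ / 2 := by linarith [hδ.1]
  calc _ ≤ _ := measure_mono hsub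
    _ ≤ _ := measure_union_le _ _
    _ ≤ ENNReal.ofReal (δ / 2) + ENNReal.ofReal (δ / 2) :=
        add_le_add (hsum.trans (ENNReal.ofReal_le_ofReal hnum)) hG
    _ = ENNReal.ofReal δ := by
        rw [← ENNReal.ofReal_add (by linarith [hδ.1]) (by linarith [hδ.1]), add_halves]

end run
end ProgControl

open ProgControl in
theorem mainTheorem4 {δ α : ℝ} (hδ : δ ∈ Set.Ioo (0 : ℝ) 1) (hα : α ∈ Set.Ioo (0 : ℝ) 1)
    {N T d : ℕ} (hTN : (T : ℝ) ≤ (N : ℝ) / 2)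
    (f : Fin N → ProgControl.UnitBall T → ℝ) (hf : ProgControl.IsRobustZeroChain α f)
    (hd : (T : ℝ) + 2 / α ^ 2 * Real.log (4 * (N : ℝ) * (T : ℝ) ^ 2 / δ) ≤ (d : ℝ))
    {R : Type*} [MeasurableSpace R] (O : ProgControl.LocalOracle (ProgControl.UnitBall d) R)
    {Z : Type*} [MeasurableSpace Z] (ν : MeasureTheory.Measure Z)
    [MeasureTheory.IsProbabilityMeasure ν]
    (A : ProgControl.NElementAlgorithm N (ProgControl.UnitBall d) Z R)
    (hA : ∀ t : ℕ, Measurable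
      fun ω : Z × Equiv.Perm (Fin N) × ProgControl.Stiefel d T =>
        A.query O (ProgControl.randomizedInstance f ω.2.1 ω.2.2) ω.1 t) :
    ENNReal.ofReal (1 - δ) ≤
      (ν.prod ((ProgControl.permUniform N).prod (ProgControl.stiefelUniform d T)))
        {ω | ∀ t : ℕ, ((t + 1 : ℕ) : ℝ) ≤ 1 / 16 * (N : ℝ) * ((T : ℝ) - Real.log (2 / δ)) →
          ProgControl.prog α (ProgControl.pullback ω.2.2
            (A.query O (ProgControl.randomizedInstance f ω.2.1 ω.2.2) ω.1 t).2.1) < T} := by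
  have hTd : T ≤ d := by
    have hlog : 0 ≤ Real.log (4 * (N : ℝ) * (T : ℝ) ^ 2 / δ) := by
      -- For `T = 0` the logarithm is `Real.log 0 = 0`.
      rcases Nat.eq_zero_or_pos T with rfl | hT
      · simp
      · have hT' : (1 : ℝ) ≤ T := Nat.one_le_cast.2 hT
        refine Real.log_nonneg ((one_le_div hδ.1).2 ?_)
        nlinarith [hδ.2, one_le_pow₀ hT' (n := 2)]
    have h2 : 0 ≤ 2 / α ^ 2 * Real.log (4 * (N : ℝ) * (T : ℝ) ^ 2 / δ) := by positivity
    have h3 : (T : ℝ) ≤ d := by linarith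
    exact_mod_cast h3
  have hst := isProbabilityMeasure_stiefelUniform hTd
  by_cases hL : 0 < 1 / 16 * (N : ℝ) * ((T : ℝ) - Real.log (2 / δ))
  swap
  -- A nonpositive time bound admits no query, so the event is everything.
  · have huniv : {ω : Z × Equiv.Perm (Fin N) × Stiefel d T | ∀ t : ℕ,
        ((t + 1 : ℕ) : ℝ) ≤ 1 / 16 * (N : ℝ) * ((T : ℝ) - Real.log (2 / δ)) →
          prog α (pullback ω.2.2 (A.query O (randomizedInstance f ω.2.1 ω.2.2) ω.1 t).2.1) < T} =
        Set.univ := by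
      refine Set.eq_univ_of_forall fun ω t ht => absurd (lt_of_lt_of_le ?_ ht) hL
      exact Nat.cast_pos.2 t.succ_pos
    rw [huniv, measure_univ]
    exact ENNReal.ofReal_le_one.2 (by linarith [hδ.1])
  set n := ⌊1 / 16 * (N : ℝ) * ((T : ℝ) - Real.log (2 / δ))⌋₊ with hn
  have hlog : 0 ≤ Real.log (2 / δ) :=
    Real.log_nonneg ((one_le_div hδ.1).2 (by linarith [hδ.2]))
  have hL' : 0 < (T : ℝ) - Real.log (2 / δ) := pos_of_mul_pos_right hL (by positivity)
  have hT : 0 < T := Nat.cast_pos.1 (by linarith : (0 : ℝ) < T)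
  set S := {ω : Z × Equiv.Perm (Fin N) × Stiefel d T | ∃ t < n,
    T ≤ prog α (pullback ω.2.2 (A.query O (randomizedInstance f ω.2.1 ω.2.2) ω.1 t).2.1)} with hS
  have hset : {ω : Z × Equiv.Perm (Fin N) × Stiefel d T | ∀ t : ℕ,
        ((t + 1 : ℕ) : ℝ) ≤ 1 / 16 * (N : ℝ) * ((T : ℝ) - Real.log (2 / δ)) →
          prog α (pullback ω.2.2 (A.query O (randomizedInstance f ω.2.1 ω.2.2) ω.1 t).2.1) < T} =
      Sᶜ := by
    ext ω
    simp only [hS, Set.mem_compl_iff, Set.mem_ofPred_eq, not_exists, not_and, not_le]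
    refine forall_congr' fun t => ?_
    rw [← Nat.le_floor_iff hL.le, ← hn, Nat.succ_le_iff]
  have hSm : MeasurableSet S := by
    have h1 : ∀ t, MeasurableSet {ω : Z × Equiv.Perm (Fin N) × Stiefel d T |
        T ≤ prog α (pullback ω.2.2
          (A.query O (randomizedInstance f ω.2.1 ω.2.2) ω.1 t).2.1)} := by
      intro t
      have h2 := (measurable_snd.comp
        (measurable_snd (α := Z) (β := Equiv.Perm (Fin N) × Stiefel d T))).prodMk
        (measurable_subtype_coe.comp (measurable_snd.comp (hA t)))
      have h3 := (measurable_prog_pullback (d := d) (T := T) α).comp h2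
      exact measurableSet_le measurable_const h3
    have h4 : S = ⋃ t ∈ Set.Iio n, {ω : Z × Equiv.Perm (Fin N) × Stiefel d T |
        T ≤ prog α (pullback ω.2.2
          (A.query O (randomizedInstance f ω.2.1 ω.2.2) ω.1 t).2.1)} := by
      ext ω
      simp [hS]
    rw [h4]
    exact MeasurableSet.biUnion (Set.to_countable _) fun t _ => h1 t
  have hbound : (ν.prod ((permUniform N).prod (stiefelUniform d T))) S ≤ ENNReal.ofReal δ := by
    -- It suffices to bound the section at each fixed `ζ`.
    rw [Measure.prod_apply hSm]
    refine (lintegral_mono fun ζ => ?_).trans (b := ∫⁻ _, ENNReal.ofReal δ ∂ν) (by simp)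
    have hq : ∀ t, Measurable fun c : Equiv.Perm (Fin N) × Stiefel d T =>
        runQuery f O A ζ c t := fun t => (hA t).comp measurable_prodMk_left
    exact measure_full_progress_le hq hf hα.1 hδ hT hTN hTd hd (Nat.floor_le hL.le) hL'.le
  rw [hset, prob_compl_eq_one_sub hSm, ENNReal.ofReal_sub _ hδ.1.le, ENNReal.ofReal_one]
  exact tsub_le_tsub_left hbound 1
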